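/- Let $\mathbb D$ be the open unit disc and $\mathbb T$ the unit circle. For an arc $I\subset\mathbb T$ of length $|I|\in(0,2\pi]$ (the whole circle is allowed) let $$S(I)=\Big\{re^{it}: e^{it}\in I,\ 1-\tfrac{|I|}{2\pi}\le r<1\Big\}.$$ For $s>0$ and $M>0$, a positive Borel measure $\mu$ on $\mathbb D$ is an $s$-Carleson measure with constant $M$ if $\mu(S(I))\le M|I|^s$ for every arc $I\subset\mathbb T$; it is an $s$-Carleson measure if this holds for some $M>0$. Let $$\beta(z,w)=\frac12\log\frac{1+|\varphi_z(w)|}{1-|\varphi_z(w)|},\qquad \varphi_z(w)=\frac{z-w}{1-\bar z w},\qquad z,w\in\mathbb D,$$ be the hyperbolic metric on $\mathbb D$. **Theorem.** Let $1<p<\infty$. There is a constant $C=C(p)>0$, depending only on $p$, such that for every $M>0$ and every positive Borel measure $\mu$ on $\mathbb D$ that is a $2p$-Carleson measure with constant $M$, the integral $$G_\mu(z)=\int_{\mathbb D}\frac{(1-|w|^2)^2}{|1-\bar z w|^4}\,d\mu(w)$$ (the B-balayage of $\mu$) converges for every $z\in\mathbb D$, and $$|G_\mu(z)-G_\mu(w)|\le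 C\,M\,\beta(z,w)^{1/p}\qquad\text{for all } z,w\in\mathbb D.$$ In particular, if $\mu$ is a $2p$-Carleson measure, then $G_\mu$ is Hölder continuous of order $1/p$ with respect to $\beta$. -/

import Mathlib

open MeasureTheory
open scoped ComplexConjugate Complex.UnitDisc

/-- The open unit disc `𝔻` carries its Borel `σ`-algebra. -/
noncomputable instance : MeasurableSpace 𝔻 := borel 𝔻

instance : BorelSpace 𝔻 := ⟨rfl⟩

/-- The Carleson square `S(I) = {r e^{it} : e^{it} ∈ I, 1 - |I|/(2π) ≤ r < 1}` over the closed arc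
`I = {e^{it} : a ≤ t ≤ a + ℓ}` of length `|I| = ℓ`, meant for `0 < ℓ ≤ 2π`
(for `ℓ = 2π` the arc is the whole circle). -/
def carlesonSquare (a ℓ : ℝ) : Set 𝔻 :=
  {z | ∃ r t : ℝ, t ∈ Set.Icc a (a + ℓ) ∧ 1 - ℓ / (2 * Real.pi) ≤ r ∧ r < 1 ∧
    (z : ℂ) = (r : ℂ) * Complex.exp (t * Complex.I)}

/-- `μ` is an `s`-Carleson measure with constant `M`: `μ(S(I)) ≤ M |I|^s` for every arc `I` of the
unit circle. -/
def IsCarlesonWith (s M : ℝ) (μ : Measure 𝔻) : Prop :=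
  ∀ a ℓ : ℝ, 0 < ℓ → ℓ ≤ 2 * Real.pi → μ (carlesonSquare a ℓ) ≤ ENNReal.ofReal (M * ℓ ^ s)

/-- The kernel `(1 - |w|²)² / |1 - z̄ w|⁴`. -/
noncomputable def bKernel (z w : 𝔻) : ℝ :=
  (1 - ‖(w : ℂ)‖ ^ 2) ^ 2 / ‖1 - conj (z : ℂ) * (w : ℂ)‖ ^ 4

/-- The B-balayage `G_μ(z) = ∫ (1 - |w|²)² / |1 - z̄ w|⁴ dμ(w)`. -/
noncomputable def bBalayage (μ : Measure 𝔻) (z : 𝔻) : ℝ :=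
  ∫ w, bKernel z w ∂μ

/-- The disc automorphism `φ_z(w) = (z - w) / (1 - z̄ w)`. -/
noncomputable def discAut (z w : 𝔻) : ℂ :=
  ((z : ℂ) - (w : ℂ)) / (1 - conj (z : ℂ) * (w : ℂ))

/-- The hyperbolic metric `β(z,w) = (1/2) log ((1 + |φ_z(w)|) / (1 - |φ_z(w)|))` of the disc. -/
noncomputable def hypDist (z w : 𝔻) : ℝ :=
  1 / 2 * Real.log ((1 + ‖discAut z w‖) / (1 - ‖discAut z w‖))

/-! Write `ρ = |φ_z(w)|` and `K_z` for the kernel. Two facts suffice: `|K_z - K_w| ≤ 4ρ (K_z + K_w)`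
pointwise (`abs_bKernel_sub_le`), and `∫ K_z dμ ≤ A M` uniformly in `z`
(`IsCarlesonWith.lintegral_bKernel_le`). Together they give the Lipschitz bound `|G(z) - G(w)| ≤ 8 A
M ρ`. Since `ρ < 1`, also `ρ ≤ ρ^(1/p) ≤ β^(1/p)`. The uniform bound is dyadic: `K_z ≤ 4 / |1 - z̄
u|²`, and the ball `|1 - z̄ u| ≤ t` has mass `O(M t^(2p))`, so the sum over `t = 2^(1-k)` is
geometric because `2p > 2`. -/

/-- The kernel pairing `|1 - z̄ w|` of two points of the disc is positive. -/
theorem norm_one_sub_conj_mul_pos (z w : 𝔻) : 0 < ‖1 - conj (z : ℂ) * (w : ℂ)‖ := by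
  have h1 : ‖conj (z : ℂ) * (w : ℂ)‖ < 1 := by
    rw [norm_mul, RCLike.norm_conj]
    have := z.norm_lt_one
    have := w.norm_lt_one
    nlinarith [norm_nonneg (z : ℂ), norm_nonneg (w : ℂ)]
  rw [norm_pos_iff, sub_ne_zero]
  intro h
  rw [← h] at h1
  simp at h1

theorem one_sub_norm_le_norm_one_sub_conj_mul (z w : 𝔻) :
    1 - ‖(w : ℂ)‖ ≤ ‖1 - conj (z : ℂ) * (w : ℂ)‖ := by
  have h := norm_sub_norm_le (1 : ℂ) (conj (z : ℂ) * (w : ℂ))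
  rw [norm_mul, RCLike.norm_conj, norm_one] at h
  nlinarith [norm_nonneg (w : ℂ), z.norm_lt_one]

theorem norm_one_sub_conj_mul_le_two (z w : 𝔻) : ‖1 - conj (z : ℂ) * (w : ℂ)‖ ≤ 2 := by
  have h := norm_sub_le (1 : ℂ) (conj (z : ℂ) * (w : ℂ))
  rw [norm_mul, RCLike.norm_conj, norm_one] at h
  nlinarith [norm_nonneg (w : ℂ), norm_nonneg (z : ℂ), z.norm_lt_one, w.norm_lt_one]

/-- The squares differ by `(1 - |z|²)(1 - |w|²) > 0`. -/
theorem norm_sub_lt_norm_one_sub_conj_mul (z w : 𝔻) :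
    ‖(z : ℂ) - w‖ < ‖1 - conj (z : ℂ) * (w : ℂ)‖ := by
  have hz : Complex.normSq z < 1 := by
    rw [Complex.normSq_eq_norm_sq]; nlinarith [norm_nonneg (z : ℂ), z.norm_lt_one]
  have hw : Complex.normSq w < 1 := by
    rw [Complex.normSq_eq_norm_sq]; nlinarith [norm_nonneg (w : ℂ), w.norm_lt_one]
  rw [← sq_lt_sq₀ (norm_nonneg _) (norm_nonneg _), ← Complex.normSq_eq_norm_sq,
    ← Complex.normSq_eq_norm_sq]
  simp only [Complex.normSq_apply, Complex.sub_re, Complex.sub_im, Complex.mul_re, Complex.mul_im,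
    Complex.conj_re, Complex.conj_im, Complex.one_re, Complex.one_im] at *
  nlinarith [mul_pos (sub_pos.2 hz) (sub_pos.2 hw)]

theorem norm_discAut_lt_one (z w : 𝔻) : ‖discAut z w‖ < 1 := by
  rw [discAut, norm_div, div_lt_one (norm_one_sub_conj_mul_pos z w)]
  exact norm_sub_lt_norm_one_sub_conj_mul z w

theorem norm_one_sub_conj_mul_le_add (z w u : 𝔻) :
    ‖1 - conj (z : ℂ) * (w : ℂ)‖ ≤
      ‖1 - conj (z : ℂ) * (u : ℂ)‖ + ‖1 - conj (w : ℂ) * (u : ℂ)‖ := by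
  have e : 1 - conj (z : ℂ) * (w : ℂ) =
      (1 - conj (z : ℂ) * (u : ℂ)) - conj (z : ℂ) * ((w : ℂ) - u) := by ring
  rw [e]
  refine (norm_sub_le _ _).trans (add_le_add le_rfl ?_)
  rw [norm_mul, RCLike.norm_conj]
  have := norm_sub_lt_norm_one_sub_conj_mul w u
  nlinarith [norm_nonneg ((w : ℂ) - u), z.norm_lt_one]

/-- The change is at most `|z - w| = ρ |1 - z̄ w|`, and the quasi-triangle inequality passes through
`u`. -/
theorem abs_norm_one_sub_conj_mul_sub_le (z w u : 𝔻) :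
    |‖1 - conj (z : ℂ) * (u : ℂ)‖ - ‖1 - conj (w : ℂ) * (u : ℂ)‖| ≤
      ‖discAut z w‖ * (‖1 - conj (z : ℂ) * (u : ℂ)‖ + ‖1 - conj (w : ℂ) * (u : ℂ)‖) := by
  have hpos := norm_one_sub_conj_mul_pos z w
  calc _ ≤ ‖(1 - conj (z : ℂ) * (u : ℂ)) - (1 - conj (w : ℂ) * (u : ℂ))‖ :=
        abs_norm_sub_norm_le _ _
    _ = ‖conj ((z : ℂ) - w) * u‖ := by
        rw [← norm_neg]; congr 1; rw [map_sub]; ring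
    _ ≤ ‖(z : ℂ) - w‖ := by
        rw [norm_mul, RCLike.norm_conj]
        exact mul_le_of_le_one_right (norm_nonneg _) u.norm_lt_one.le
    _ = ‖discAut z w‖ * ‖1 - conj (z : ℂ) * (w : ℂ)‖ := by
        rw [discAut, norm_div, div_mul_cancel₀ _ hpos.ne']
    _ ≤ _ := mul_le_mul_of_nonneg_left (norm_one_sub_conj_mul_le_add z w u) (norm_nonneg _)

theorem bKernel_nonneg (z u : 𝔻) : 0 ≤ bKernel z u := by
  unfold bKernel; positivity

/-- The kernel is Lipschitz in its first variable for the pseudohyperbolic distance, relative to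
its own size. -/
theorem abs_bKernel_sub_le (z w u : 𝔻) :
    |bKernel z u - bKernel w u| ≤ 4 * ‖discAut z w‖ * (bKernel z u + bKernel w u) := by
  have ha := norm_one_sub_conj_mul_pos z u
  have hb := norm_one_sub_conj_mul_pos w u
  have hd := abs_norm_one_sub_conj_mul_sub_le z w u
  have hρ : 0 ≤ ‖discAut z w‖ := norm_nonneg _
  unfold bKernel
  generalize ‖1 - conj (z : ℂ) * (u : ℂ)‖ = a at *
  generalize ‖1 - conj (w : ℂ) * (u : ℂ)‖ = b at *
  generalize ‖discAut z w‖ = ρ at *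
  have hc : 0 ≤ (1 - ‖(u : ℂ)‖ ^ 2) ^ 2 := by positivity
  generalize (1 - ‖(u : ℂ)‖ ^ 2) ^ 2 = c at *
  -- The relative bound survives inversion, which reduces the claim to factoring `x⁴ - y⁴`.
  have hxy : |a⁻¹ - b⁻¹| ≤ ρ * (a⁻¹ + b⁻¹) := by
    have e1 : a⁻¹ - b⁻¹ = (b - a) * (a * b)⁻¹ := by field_simp
    have e2 : ρ * (a⁻¹ + b⁻¹) = ρ * (a + b) * (a * b)⁻¹ := by field_simp; ring
    rw [e1, e2, abs_mul, abs_of_pos (a := (a * b)⁻¹) (by positivity), abs_sub_comm]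
    gcongr
  have hx : 0 < a⁻¹ := by positivity
  have hy : 0 < b⁻¹ := by positivity
  rw [div_eq_mul_inv, div_eq_mul_inv, ← inv_pow, ← inv_pow]
  generalize a⁻¹ = x at *
  generalize b⁻¹ = y at *
  have e : c * x ^ 4 - c * y ^ 4 = (x - y) * (c * ((x + y) * (x ^ 2 + y ^ 2))) := by ring
  rw [e, abs_mul, abs_of_nonneg (a := c * _) (by positivity)]
  calc _ ≤ ρ * (x + y) * (c * ((x + y) * (x ^ 2 + y ^ 2))) := by gcongr
    _ = ρ * c * ((x + y) ^ 2 * (x ^ 2 + y ^ 2)) := by ring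
    _ ≤ ρ * c * (4 * (x ^ 4 + y ^ 4)) := by
        refine mul_le_mul_of_nonneg_left ?_ (by positivity)
        calc (x + y) ^ 2 * (x ^ 2 + y ^ 2) ≤ (2 * (x ^ 2 + y ^ 2)) * (x ^ 2 + y ^ 2) := by
              gcongr; nlinarith [sq_nonneg (x - y)]
          _ ≤ _ := by nlinarith [sq_nonneg (x ^ 2 - y ^ 2)]
    _ = _ := by ring

theorem bKernel_le (z u : 𝔻) : bKernel z u ≤ 4 / ‖1 - conj (z : ℂ) * (u : ℂ)‖ ^ 2 := by
  have ha := norm_one_sub_conj_mul_pos z u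
  have h1 := one_sub_norm_le_norm_one_sub_conj_mul z u
  have hu := u.norm_lt_one
  have hu0 := norm_nonneg (u : ℂ)
  unfold bKernel
  generalize ‖1 - conj (z : ℂ) * (u : ℂ)‖ = a at *
  generalize ‖(u : ℂ)‖ = r at *
  have h2 : 1 - r ^ 2 ≤ 2 * a := by nlinarith
  have h3 : 0 ≤ 1 - r ^ 2 := by nlinarith
  calc (1 - r ^ 2) ^ 2 / a ^ 4 ≤ (2 * a) ^ 2 / a ^ 4 := by gcongr
    _ = 4 / a ^ 2 := by field_simp; norm_num

/-- `β = artanh ρ`, whose power series has nonnegative terms and first term `ρ`. -/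
theorem norm_discAut_le_hypDist (z w : 𝔻) : ‖discAut z w‖ ≤ hypDist z w := by
  have h1 := norm_discAut_lt_one z w
  have h0 := norm_nonneg (discAut z w)
  unfold hypDist
  generalize ‖discAut z w‖ = x at *
  have hs := Real.hasSum_log_sub_log_of_abs_lt_one (x := x) (by rw [abs_of_nonneg h0]; exact h1)
  have := le_hasSum hs 0 (fun k _ => by positivity)
  rw [Real.log_div (by linarith) (by linarith)]
  norm_num at this
  linarith

/-! ### Nonisotropic balls and Carleson squares -/

/-- The angle of a complex number close to `1` is controlled by its distance to `1`. -/
theorem Complex.abs_arg_le_of_norm_one_sub_lt_one {v : ℂ} (hv : ‖1 - v‖ < 1) :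
    |v.arg| ≤ Real.pi / 2 * ‖1 - v‖ := by
  have hre : 0 < v.re := by
    have := Complex.re_le_norm (1 - v)
    simp at this
    linarith
  have hpi := Complex.abs_arg_le_pi_div_two_iff.2 hre.le
  have hv0 : 0 < ‖v‖ := norm_pos_iff.2 (by rintro rfl; simp at hre)
  have hsin : |Real.sin v.arg| ≤ ‖1 - v‖ := by
    rw [Complex.sin_arg, abs_div, abs_of_pos hv0, div_le_iff₀ hv0,
      ← abs_of_nonneg (mul_nonneg (norm_nonneg (1 - v)) hv0.le), ← sq_le_sq, mul_pow,
      ← Complex.normSq_eq_norm_sq, ← Complex.normSq_eq_norm_sq]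
    simp only [Complex.normSq_apply, Complex.sub_re, Complex.sub_im, Complex.one_re,
      Complex.one_im]
    -- This square is exactly `|1 - v|² |v|² - (Im v)²`.
    nlinarith [sq_nonneg (v.re ^ 2 - v.re + v.im ^ 2)]
  have h := Real.mul_abs_le_abs_sin hpi
  have hp := Real.pi_pos
  calc |v.arg| = Real.pi / 2 * (2 / Real.pi * |v.arg|) := by field_simp
    _ ≤ _ := by gcongr; exact h.trans hsin

theorem carlesonSquare_two_pi (a : ℝ) : carlesonSquare a (2 * Real.pi) = Set.univ := by
  refine Set.eq_univ_of_forall fun z => ?_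
  have hp : (0 : ℝ) < 2 * Real.pi := by positivity
  refine ⟨‖(z : ℂ)‖, toIcoMod hp a (Complex.arg z), ?_, ?_, z.norm_lt_one, ?_⟩
  · exact Set.Ico_subset_Icc_self (toIcoMod_mem_Ico hp _ _)
  · rw [div_self hp.ne']; simp
  · conv_lhs => rw [← Complex.norm_mul_exp_arg_mul_I (z : ℂ)]
    congr 1
    rw [toIcoMod, Complex.exp_eq_exp_iff_exists_int]
    refine ⟨toIcoDiv hp a (Complex.arg z), ?_⟩
    push_cast [zsmul_eq_mul]
    ring

/-- A nonisotropic ball of radius `t < 1` lies in a Carleson square of size `2πt`. -/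
theorem setOf_norm_one_sub_conj_mul_le_subset_carlesonSquare (z : 𝔻) {t : ℝ} (ht : t < 1) :
    {u : 𝔻 | ‖1 - conj (z : ℂ) * (u : ℂ)‖ ≤ t} ⊆
      carlesonSquare (Complex.arg z - Real.pi / 2 * t) (2 * Real.pi * t) := by
  intro u hu
  have hu' : ‖1 - conj (z : ℂ) * (u : ℂ)‖ ≤ t := hu
  have hpi := Real.pi_pos
  have ht0 : 0 ≤ t := (norm_nonneg _).trans hu'
  have hlt := hu'.trans_lt ht
  have harg := abs_le.1 ((Complex.abs_arg_le_of_norm_one_sub_lt_one hlt).trans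
    (mul_le_mul_of_nonneg_left hu' (by positivity)))
  have hz0 : (z : ℂ) ≠ 0 := by
    intro h
    rw [h] at hlt
    simp at hlt
  -- The angle of `z̄ u` only needs an arc of length `πt`; the length `2πt` is dictated by the
  -- radial depth `t`.
  refine ⟨‖(u : ℂ)‖, Complex.arg z + Complex.arg (conj (z : ℂ) * u), ⟨?_, ?_⟩, ?_,
    u.norm_lt_one, ?_⟩
  · linarith [harg.1]
  · nlinarith [harg.2, mul_nonneg hpi.le ht0]
  · rw [mul_div_cancel_left₀ _ (by positivity)]
    linarith [one_sub_norm_le_norm_one_sub_conj_mul z u]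
  · have h1 := Complex.norm_mul_exp_arg_mul_I (conj (z : ℂ) * u)
    have h2 := Complex.norm_mul_exp_arg_mul_I (z : ℂ)
    have h3 : conj (z : ℂ) ≠ 0 := by simpa using hz0
    have h4 : conj (z : ℂ) * z = ‖(z : ℂ)‖ ^ 2 := Complex.conj_mul' _
    have h5 : (‖(z : ℂ)‖ : ℂ) ≠ 0 := by simpa using hz0
    refine mul_left_cancel₀ h3 (mul_left_cancel₀ h5 ?_)
    rw [norm_mul, RCLike.norm_conj, Complex.ofReal_mul] at h1
    push_cast
    rw [add_mul, Complex.exp_add]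
    generalize Complex.exp (Complex.arg z * Complex.I) = e at *
    generalize Complex.exp (Complex.arg (conj (z : ℂ) * u) * Complex.I) = f at *
    linear_combination (-(‖(z : ℂ)‖ : ℂ)) * h1 - (‖(u : ℂ)‖ : ℂ) * f * h4
      - conj (z : ℂ) * ‖(u : ℂ)‖ * f * h2

theorem IsCarlesonWith.measure_setOf_norm_one_sub_conj_mul_le {s M : ℝ} {μ : Measure 𝔻}
    (hμ : IsCarlesonWith s M μ) (hs : 0 ≤ s) (hM : 0 ≤ M) (z : 𝔻) {t : ℝ} (ht : 0 < t) :
    μ {u : 𝔻 | ‖1 - conj (z : ℂ) * (u : ℂ)‖ ≤ t} ≤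
      ENNReal.ofReal (M * (2 * Real.pi * t) ^ s) := by
  have hpi := Real.pi_pos
  rcases lt_or_ge t 1 with h | h
  -- Arcs have length at most `2π`, so `t ≥ 1` is handled by the whole disc.
  · refine (measure_mono (setOf_norm_one_sub_conj_mul_le_subset_carlesonSquare z h)).trans ?_
    exact hμ _ _ (by positivity) (by nlinarith)
  · refine (measure_mono (Set.subset_univ _)).trans ?_
    rw [← carlesonSquare_two_pi 0]
    refine (hμ 0 _ (by positivity) le_rfl).trans (ENNReal.ofReal_le_ofReal ?_)
    exact mul_le_mul_of_nonneg_left (Real.rpow_le_rpow (by positivity) (by nlinarith) hs) hM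

/-! ### Dyadic integration of the kernel -/

theorem continuous_bKernel (z : 𝔻) : Continuous (bKernel z) := by
  unfold bKernel
  have hc : Continuous fun w : 𝔻 => (w : ℂ) := continuous_induced_dom
  refine Continuous.div (by fun_prop) (by fun_prop) fun w => ?_
  exact pow_ne_zero _ (norm_one_sub_conj_mul_pos z w).ne'

/-- Dyadic domination of the kernel by indicators of nonisotropic balls. -/
theorem exists_bKernel_le_four_pow (z u : 𝔻) :
    ∃ k : ℕ, ‖1 - conj (z : ℂ) * (u : ℂ)‖ ≤ 2 * (1 / 2) ^ k ∧ bKernel z u ≤ 4 * 4 ^ k := by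
  have ha := norm_one_sub_conj_mul_pos z u
  have ha2 := norm_one_sub_conj_mul_le_two z u
  have hK := bKernel_le z u
  generalize ‖1 - conj (z : ℂ) * (u : ℂ)‖ = a at *
  obtain ⟨k, hk1, hk2⟩ := exists_nat_pow_near_of_lt_one (x := a / 2) (y := 1 / 2) (by positivity)
    (by linarith) (by norm_num) (by norm_num)
  refine ⟨k, by linarith, hK.trans ?_⟩
  have h : (1 / 2) ^ k ≤ a := by rw [pow_succ] at hk1; linarith
  calc 4 / a ^ 2 ≤ 4 / ((1 / 2) ^ k) ^ 2 := by gcongr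
    _ = 4 * 4 ^ k := by
      rw [← pow_mul, mul_comm k 2, pow_mul, div_eq_mul_inv, ← inv_pow]; norm_num

/-- Ratio of the dyadic series: kernel growth `4^k` against mass decay `2^(-2pk)`. -/
theorem four_mul_half_rpow_lt_one {p : ℝ} (hp : 1 < p) : (4 : ℝ) * (1 / 2) ^ (2 * p) < 1 := by
  have : (1 / 2 : ℝ) ^ (2 * p) < (1 / 2) ^ (2 : ℝ) :=
    Real.rpow_lt_rpow_of_exponent_gt (by norm_num) (by norm_num) (by linarith)
  norm_num at this ⊢
  linarith

theorem IsCarlesonWith.lintegral_bKernel_le {p M : ℝ} {μ : Measure 𝔻} (hp : 1 < p)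
    (hM : 0 ≤ M) (hμ : IsCarlesonWith (2 * p) M μ) (z : 𝔻) :
    ∫⁻ u, ENNReal.ofReal (bKernel z u) ∂μ ≤
      ENNReal.ofReal (M * (4 * (4 * Real.pi) ^ (2 * p)) * (1 - 4 * (1 / 2) ^ (2 * p))⁻¹) := by
  have hpi := Real.pi_pos
  have hc : Continuous fun w : 𝔻 => (w : ℂ) := continuous_induced_dom
  set B : ℕ → Set 𝔻 := fun k => {u : 𝔻 | ‖1 - conj (z : ℂ) * (u : ℂ)‖ ≤ 2 * (1 / 2) ^ k} with hB
  have hBm : ∀ k, MeasurableSet (B k) := fun k =>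
    (isClosed_le (by fun_prop) continuous_const).measurableSet
  have hq0 : (0 : ℝ) ≤ 4 * (1 / 2) ^ (2 * p) := by positivity
  have hq1 := four_mul_half_rpow_lt_one hp
  calc ∫⁻ u, ENNReal.ofReal (bKernel z u) ∂μ
      ≤ ∫⁻ u, ∑' k, (B k).indicator (fun _ => ENNReal.ofReal (4 * 4 ^ k)) u ∂μ := by
        refine lintegral_mono fun u => ?_
        obtain ⟨k, hk, hK⟩ := exists_bKernel_le_four_pow z u
        refine le_trans ?_ (ENNReal.le_tsum k)
        rw [Set.indicator_of_mem (show u ∈ B k from hk)]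
        exact ENNReal.ofReal_le_ofReal hK
    _ = ∑' k, ENNReal.ofReal (4 * 4 ^ k) * μ (B k) := by
        rw [lintegral_tsum fun k => (measurable_const.indicator (hBm k)).aemeasurable]
        simp_rw [lintegral_indicator_const (hBm _)]
    _ ≤ ∑' k : ℕ, ENNReal.ofReal
          (M * (4 * (4 * Real.pi) ^ (2 * p)) * (4 * (1 / 2) ^ (2 * p)) ^ k) := by
        refine ENNReal.tsum_le_tsum fun k => ?_
        refine (mul_le_mul_right (hμ.measure_setOf_norm_one_sub_conj_mul_le (by linarith) hM z
          (by positivity)) _).trans ?_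
        rw [← ENNReal.ofReal_mul (by positivity)]
        refine ENNReal.ofReal_le_ofReal (le_of_eq ?_)
        rw [show 2 * Real.pi * (2 * (1 / 2) ^ k) = 4 * Real.pi * (1 / 2) ^ k by ring,
          Real.mul_rpow (by positivity) (by positivity), mul_pow,
          ← Real.rpow_natCast (1 / 2), ← Real.rpow_natCast ((1 / 2) ^ (2 * p)),
          ← Real.rpow_mul (by norm_num), ← Real.rpow_mul (by norm_num), mul_comm (k : ℝ)]
        ring
    _ = _ := by
        rw [← ENNReal.ofReal_tsum_of_nonneg (fun k => by positivity)
          ((summable_geometric_of_lt_one hq0 hq1).mul_left _), tsum_mul_left,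
          tsum_geometric_of_lt_one hq0 hq1]

theorem theorem1 (p : ℝ) (hp : 1 < p) :
    ∃ C : ℝ, 0 < C ∧ ∀ (μ : Measure 𝔻) (M : ℝ), 0 < M → IsCarlesonWith (2 * p) M μ →
      (∀ z : 𝔻, Integrable (bKernel z) μ) ∧
      ∀ z w : 𝔻, |bBalayage μ z - bBalayage μ w| ≤ C * M * hypDist z w ^ (1 / p) := by
  have hpi := Real.pi_pos
  have hq1 := four_mul_half_rpow_lt_one hp
  have hq : 0 < (1 - (4 : ℝ) * (1 / 2) ^ (2 * p))⁻¹ := inv_pos.2 (sub_pos.2 hq1)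
  set A : ℝ := (4 * (4 * Real.pi) ^ (2 * p)) * (1 - 4 * (1 / 2) ^ (2 * p))⁻¹ with hA
  have hA0 : 0 < A := by positivity
  refine ⟨8 * A, by positivity, fun μ M hM hμ => ?_⟩
  have hbound : ∀ z, ∫⁻ u, ENNReal.ofReal (bKernel z u) ∂μ ≤ ENNReal.ofReal (M * A) := fun z => by
    rw [hA, ← mul_assoc]
    exact hμ.lintegral_bKernel_le hp hM.le z
  have hint : ∀ z, Integrable (bKernel z) μ := fun z =>
    (lintegral_ofReal_ne_top_iff_integrable (continuous_bKernel z).aestronglyMeasurable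
      (Filter.Eventually.of_forall (bKernel_nonneg z))).1
      ((hbound z).trans_lt ENNReal.ofReal_lt_top).ne
  have hG : ∀ z, bBalayage μ z ≤ M * A := fun z => by
    rw [bBalayage, integral_eq_lintegral_of_nonneg_ae
      (Filter.Eventually.of_forall (bKernel_nonneg z))
      (continuous_bKernel z).aestronglyMeasurable]
    exact ENNReal.toReal_le_of_le_ofReal (by positivity) (hbound z)
  refine ⟨hint, fun z w => ?_⟩
  have hρ0 := norm_nonneg (discAut z w)
  have hρ1 := norm_discAut_lt_one z w
  have hp0 : 0 < 1 / p := by positivity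
  calc |bBalayage μ z - bBalayage μ w| = |∫ u, (bKernel z u - bKernel w u) ∂μ| := by
        rw [integral_sub (hint z) (hint w)]; rfl
    _ ≤ ∫ u, |bKernel z u - bKernel w u| ∂μ := abs_integral_le_integral_abs
    _ ≤ ∫ u, 4 * ‖discAut z w‖ * (bKernel z u + bKernel w u) ∂μ :=
        integral_mono ((hint z).sub (hint w)).abs (((hint z).add (hint w)).const_mul _)
          fun u => abs_bKernel_sub_le z w u
    _ = 4 * ‖discAut z w‖ * (bBalayage μ z + bBalayage μ w) := by
        rw [integral_const_mul, integral_add (hint z) (hint w)]; rfl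
    _ ≤ 4 * ‖discAut z w‖ * (M * A + M * A) := by
        gcongr
        · exact hG z
        · exact hG w
    _ = 8 * A * M * ‖discAut z w‖ := by ring
    _ ≤ 8 * A * M * hypDist z w ^ (1 / p) := by
        gcongr
        calc ‖discAut z w‖ ≤ ‖discAut z w‖ ^ (1 / p) :=
              Real.self_le_rpow_of_le_one hρ0 hρ1.le (by rw [div_le_one (by linarith)]; exact hp.le)
          _ ≤ _ := Real.rpow_le_rpow hρ0 (norm_discAut_le_hypDist z w) hp0.le
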